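/- Let $n\ge 1$, $2\le p<\infty$, $\alpha=\frac{p-2}{p+n}$, $\beta=\frac{n+2}{p+n}$. Let $\Omega\subset\mathbb R^n$ be a domain contained in some ball of radius $R$, let $T,\varepsilon>0$, and put $$\Omega_T=\Omega\times(0,T),\qquad S_\varepsilon=\{x\in\mathbb R^n\setminus\Omega:\ \operatorname{dist}(x,\partial\Omega)\le\varepsilon\},\qquad \Gamma_p^\varepsilon=\bigl(S_\varepsilon\times(-\tfrac{\varepsilon^2}{2},T]\bigr)\cup\bigl(\Omega\times(-\tfrac{\varepsilon^2}{2},0]\bigr).$$ Let $F:\Gamma_p^\varepsilon\to\mathbb R$ and $\psi:\mathbb R^{n+1}\to\mathbb R$ satisfy $$|F(x,t)-F(y,s)|\le C_1\bigl(|x-y|+|t-s|^{1/2}\bigr),\qquad |\psi(x,t)-\psi(y,s)|\le C_2\bigl(|x-y|+|t-s|^{1/2}\bigr)$$ on their domains, and $\psi\le F$ on $\Gamma_p^\varepsilon$. Let $u^\varepsilon:\Omega_T\cup\Gamma_p^\varepsilon\to\mathbb R$ be a bounded Borel function with $u^\varepsilon=F$ on $\Gamma_p^\varepsilon$ and, for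 all $(x,t)\in\Omega_T$, $$u^\varepsilon(x,t)=\max\Bigl\{\psi(x,t),\ \tfrac{\alpha}{2}\Bigl(\sup_{y\in B_\varepsilon(x)}u^\varepsilon(y,t-\tfrac{\varepsilon^2}{2})+\inf_{y\in B_\varepsilon(x)}u^\varepsilon(y,t-\tfrac{\varepsilon^2}{2})\Bigr)+\beta\,\frac{1}{|B_\varepsilon(x)|}\int_{B_\varepsilon(x)}u^\varepsilon(y,t-\tfrac{\varepsilon^2}{2})\,dy\Bigr\},$$ where $B_\varepsilon(x)$ is the open ball. Let $(x,t_x)\in\Omega_T$, $y\in S_\varepsilon$ and $t_y\in(-\frac{\varepsilon^2}{2},T]$, let $b\in\partial\Omega$ be a boundary point with $|y-b|\le\varepsilon$, and let $\delta>0$ be the radius of an exterior ball at $b$, that is, $B_\delta(z)\subset\mathbb R^n\setminus\Omega$ and $b\in\partial B_\delta(z)$ for some $z\in\mathbb R^n$. Then $$|u^\varepsilon(x,t_x)-u^\varepsilon(y,t_y)|\le C\Bigl(\min\{|x-y|^{1/2}+\varepsilon^{1/2},\,t_x^{1/2}+\varepsilon\}+\min\{|x-y|+\varepsilon,\,t_x+\varepsilon^2\}\Bigr)+C_{F,\psi}\bigl(|t_x-t_y|^{1/2}+|x-y|+\delta\bigr),$$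 where the constant $C_{F,\psi}$ depends only on $C_1,C_2$, and the constant $C$ depends only on $C_1,C_2,n,p,R,\delta$; in particular neither depends on $\varepsilon$, $T$ or the points. -/

import Mathlib

/-- `ℝⁿ` with its Euclidean norm. -/
abbrev Rn (n : ℕ) : Type := EuclideanSpace ℝ (Fin n)

/-- The space-time cylinder `Ω_T = Ω × (0, T)`. -/
def spaceTimeCylinder {n : ℕ} (Ω : Set (Rn n)) (T : ℝ) : Set (Rn n × ℝ) :=
  Ω ×ˢ Set.Ioo 0 T

/-- The outer boundary strip `S_ε = {x ∈ ℝⁿ \ Ω : dist (x, ∂Ω) ≤ ε}`. -/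
def boundaryStrip {n : ℕ} (Ω : Set (Rn n)) (ε : ℝ) : Set (Rn n) :=
  {x | x ∉ Ω ∧ Metric.infDist x (frontier Ω) ≤ ε}

/-- The parabolic boundary strip
`Γ_p^ε = (S_ε × (-ε²/2, T]) ∪ (Ω × (-ε²/2, 0])`. -/
def parabolicStrip {n : ℕ} (Ω : Set (Rn n)) (T ε : ℝ) : Set (Rn n × ℝ) :=
  boundaryStrip Ω ε ×ˢ Set.Ioc (-(ε ^ 2 / 2)) T ∪ Ω ×ˢ Set.Ioc (-(ε ^ 2 / 2)) 0

/-- The bound `|f(x,t) - f(y,s)| ≤ K (|x - y| + |t - s|^{1/2})` for all points of `A`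
(Lipschitz continuity for the parabolic distance). -/
def ParabolicLipschitzOn {n : ℕ} (K : ℝ) (f : Rn n × ℝ → ℝ) (A : Set (Rn n × ℝ)) : Prop :=
  ∀ q ∈ A, ∀ r ∈ A, |f q - f r| ≤ K * (dist q.1 r.1 + Real.sqrt |q.2 - r.2|)

/-- There is an exterior ball of radius `δ` at `b`: an open ball `B_δ(z) ⊆ ℝⁿ \ Ω` with
`b ∈ ∂B_δ(z)`. The exterior sphere condition asks for this, with some `δ > 0`, at every
`b ∈ ∂Ω`. -/
def HasExteriorBallAt {n : ℕ} (Ω : Set (Rn n)) (b : Rn n) (δ : ℝ) : Prop :=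
  ∃ z : Rn n, Metric.ball z δ ⊆ Ωᶜ ∧ b ∈ Metric.sphere z δ

/-- The weight `α = (p - 2) / (p + n)`. -/
noncomputable def tugWeight (n : ℕ) (p : ℝ) : ℝ := (p - 2) / (p + n)

/-- The weight `β = (n + 2) / (p + n)`. -/
noncomputable def noiseWeight (n : ℕ) (p : ℝ) : ℝ := (n + 2) / (p + n)

/-- One round of tug-of-war with noise, evaluated on the function `v` of the next position:
`(α/2) (sup_{B_ε(x)} v + inf_{B_ε(x)} v) + β ⨍_{B_ε(x)} v`. -/
noncomputable def tugAverage {n : ℕ} (p ε : ℝ) (v : Rn n → ℝ) (x : Rn n) : ℝ :=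
  tugWeight n p / 2 * (sSup (v '' Metric.ball x ε) + sInf (v '' Metric.ball x ε)) +
    noiseWeight n p * ⨍ y in Metric.ball x ε, v y

/-- `u` is a bounded Borel solution on `Ω_T ∪ Γ_p^ε` of the dynamic programming principle of
the parabolic obstacle tug-of-war with noise, with boundary data `F` and obstacle `ψ`.
Values of `u` outside `Ω_T ∪ Γ_p^ε` play no role. -/
structure IsObstacleDPPSolution {n : ℕ} (p : ℝ) (Ω : Set (Rn n)) (T ε : ℝ)
    (F ψ u : Rn n × ℝ → ℝ) : Prop where
  borel : Measurable ((spaceTimeCylinder Ω T ∪ parabolicStrip Ω T ε).domRestrict u)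
  bounded : ∃ M : ℝ, ∀ q ∈ spaceTimeCylinder Ω T ∪ parabolicStrip Ω T ε, |u q| ≤ M
  dpp : ∀ x t, (x, t) ∈ spaceTimeCylinder Ω T →
    u (x, t) = max (ψ (x, t)) (tugAverage p ε (fun y => u (y, t - ε ^ 2 / 2)) x)
  boundary : ∀ q ∈ parabolicStrip Ω T ε, u q = F q

open MeasureTheory Metric Set
open scoped RealInnerProductSpace

/-! ### One round of the game: monotonicity, affine invariance and second-moment bounds. -/

section TugAverage

/-! Let `z` be the centre of the exterior ball and `L ≥ 0` a common bound for the two Lipschitz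
constants. Suppose `W` is a supersolution of the obstacle-free dynamic programming principle up to
time `tx` that dominates the parabolic distance to `(z, tx)`. Then `L * W` plus a constant dominates
both the boundary increments and the obstacle, so comparison bounds `u - u (y, ty)` from above.
Since `u` is at least its own tug average, the same barrier bounds `-u`. This is
`IsParabolicBarrier.abs_sub_le`, resting on `le_of_supersolution`.

It remains to find barriers that are small at `(x, tx)`. The distance to `z` gains at most `ε² / δ`
per round, so adding a term linear in time gives a bound by `√tx + ε`
(`isParabolicBarrier_elapsedTime`). For a bound by `√|x - y| + √ε`, the square root of time is
replaced by a linear majorant with parameter `μ`, paid for by a strictly superharmonic radial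
profile: an exponential one for small `ε`, a concave paraboloid for large `ε`
(`exists_isParabolicBarrier_dist`). Finally `le_mul_min_add_min` turns the two separate bounds into
the sum of minima. -/

theorem tugWeight_nonneg (n : ℕ) {p : ℝ} (hp : 2 ≤ p) : 0 ≤ tugWeight n p := by
  unfold tugWeight
  have : (0 : ℝ) ≤ n := n.cast_nonneg
  exact div_nonneg (by linarith) (by linarith)

theorem noiseWeight_nonneg (n : ℕ) {p : ℝ} (hp : 2 ≤ p) : 0 ≤ noiseWeight n p := by
  unfold noiseWeight
  have : (0 : ℝ) ≤ n := n.cast_nonneg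
  exact div_nonneg (by linarith) (by linarith)

theorem tugWeight_add_noiseWeight (n : ℕ) {p : ℝ} (hp : 2 ≤ p) :
    tugWeight n p + noiseWeight n p = 1 := by
  unfold tugWeight noiseWeight
  have : (0 : ℝ) ≤ n := n.cast_nonneg
  have : p + n ≠ 0 := by linarith
  field_simp
  ring

variable {n : ℕ} {p ε : ℝ}

theorem tugAverage_neg (v : Rn n → ℝ) (x : Rn n) :
    tugAverage p ε (fun y => -v y) x = -tugAverage p ε v x := by
  have h : (fun y => -v y) '' ball x ε = -(v '' ball x ε) := by
    rw [← Set.image_neg_eq_neg, Set.image_image]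
  simp only [tugAverage, h, Real.sSup_neg, Real.sInf_neg, setAverage_eq, integral_neg,
    smul_eq_mul]
  ring

theorem measureReal_ball_pos (x : Rn n) (hε : 0 < ε) :
    0 < volume.real (ball x ε) :=
  ENNReal.toReal_pos (measure_ball_pos volume x hε).ne' measure_ball_lt_top.ne

theorem average_ball_mono {f g : Rn n → ℝ} {x : Rn n}
    (hf : IntegrableOn f (ball x ε)) (hg : IntegrableOn g (ball x ε))
    (h : ∀ y ∈ ball x ε, f y ≤ g y) :
    ⨍ y in ball x ε, f y ≤ ⨍ y in ball x ε, g y := by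
  simp only [setAverage_eq, smul_eq_mul]
  exact mul_le_mul_of_nonneg_left (setIntegral_mono_on hf hg measurableSet_ball h)
    (inv_nonneg.2 measureReal_nonneg)

theorem tugAverage_mono (hp : 2 ≤ p) (hε : 0 < ε) {f g : Rn n → ℝ} {x : Rn n}
    (hf : IntegrableOn f (ball x ε)) (hg : IntegrableOn g (ball x ε))
    (hfb : BddBelow (f '' ball x ε)) (hgb : BddAbove (g '' ball x ε))
    (h : ∀ y ∈ ball x ε, f y ≤ g y) :
    tugAverage p ε f x ≤ tugAverage p ε g x := by
  have hx : x ∈ ball x ε := mem_ball_self hε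
  have h1 : sSup (f '' ball x ε) ≤ sSup (g '' ball x ε) := by
    refine csSup_le ⟨_, mem_image_of_mem f hx⟩ ?_
    rintro _ ⟨y, hy, rfl⟩
    exact (h y hy).trans (le_csSup hgb (mem_image_of_mem g hy))
  have h2 : sInf (f '' ball x ε) ≤ sInf (g '' ball x ε) := by
    refine le_csInf ⟨_, mem_image_of_mem g hx⟩ ?_
    rintro _ ⟨y, hy, rfl⟩
    exact (csInf_le hfb (mem_image_of_mem f hy)).trans (h y hy)
  have h3 := average_ball_mono hf hg h
  unfold tugAverage
  have := tugWeight_nonneg n hp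
  have := noiseWeight_nonneg n hp
  gcongr

theorem bddAbove_image_ball {f : Rn n → ℝ} (hf : Continuous f) (x : Rn n) (ε : ℝ) :
    BddAbove (f '' ball x ε) :=
  ((isCompact_closedBall x ε).bddAbove_image hf.continuousOn).mono
    (image_mono ball_subset_closedBall)

theorem bddBelow_image_ball {f : Rn n → ℝ} (hf : Continuous f) (x : Rn n) (ε : ℝ) :
    BddBelow (f '' ball x ε) :=
  ((isCompact_closedBall x ε).bddBelow_image hf.continuousOn).mono
    (image_mono ball_subset_closedBall)

theorem integrableOn_ball {f : Rn n → ℝ} (hf : Continuous f) (x : Rn n) (ε : ℝ) :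
    IntegrableOn f (ball x ε) :=
  (hf.continuousOn.integrableOn_compact (isCompact_closedBall x ε)).mono_set
    ball_subset_closedBall

theorem tugAverage_const_add_mul (hp : 2 ≤ p) (hε : 0 < ε) (c : ℝ) {L : ℝ} (hL : 0 ≤ L)
    {f : Rn n → ℝ} (hf : Continuous f) (x : Rn n) :
    tugAverage p ε (fun y => c + L * f y) x = c + L * tugAverage p ε f x := by
  have hne : (f '' ball x ε).Nonempty := ⟨_, mem_image_of_mem f (mem_ball_self hε)⟩
  have hmono : Monotone fun s : ℝ => c + L * s := fun a b hab => by dsimp only; gcongr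
  have hcont : Continuous fun s : ℝ => c + L * s := by fun_prop
  have h1 := hmono.map_csSup_of_continuousAt hcont.continuousAt hne (bddAbove_image_ball hf x ε)
  have h2 := hmono.map_csInf_of_continuousAt hcont.continuousAt hne (bddBelow_image_ball hf x ε)
  rw [Set.image_image] at h1 h2
  have hv := (measureReal_ball_pos x hε).ne'
  have h3 : ⨍ y in ball x ε, (c + L * f y) = c + L * ⨍ y in ball x ε, f y := by
    simp only [setAverage_eq, smul_eq_mul]
    rw [integral_add (integrableOn_ball continuous_const x ε)
      ((integrableOn_ball hf x ε).const_mul L), integral_const_mul, setIntegral_const,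
      smul_eq_mul]
    field_simp
  have := tugWeight_add_noiseWeight n hp
  unfold tugAverage
  rw [← h1, ← h2, h3]
  linear_combination c * this

/-- Continuity lets the minimizing player be tested with a full step of length `ε`, although the
ball is open. -/
theorem sInf_image_ball_le (hε : 0 < ε) {f : Rn n → ℝ} (hf : Continuous f) {x q : Rn n}
    (hq : dist q x ≤ ε) : sInf (f '' ball x ε) ≤ f q := by
  have hcl : IsClosed {y | sInf (f '' ball x ε) ≤ f y} := isClosed_le continuous_const hf
  have hsub : ball x ε ⊆ {y | sInf (f '' ball x ε) ≤ f y} := fun y hy =>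
    csInf_le (bddBelow_image_ball hf x ε) (mem_image_of_mem f hy)
  refine closure_minimal hsub hcl ?_
  rw [closure_ball x hε.ne']
  exact hq

/-- A quantitative lower bound, uniform in the direction, for the second moments of a ball. -/
theorem average_inner_sq_ge (hε : 0 < ε) (w : Rn n) :
    (1 / 4) ^ n / 16 * ε ^ 2 * ‖w‖ ^ 2 ≤ ⨍ y in ball (0 : Rn n) ε, ⟪y, w⟫ ^ 2 := by
  have hcont : Continuous fun y : Rn n => ⟪y, w⟫ ^ 2 := by fun_prop
  have hV := measureReal_ball_pos (0 : Rn n) hε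
  -- The integral is bounded below by its part over a ball of radius `ε / 4`, shifted by `ε / 2`
  -- along `w`, where the inner product is at least `ε / 4 * ‖w‖`. For `w = 0` the shift is zero.
  have hsub : ball ((ε / (2 * ‖w‖)) • w) (ε / 4) ⊆ ball (0 : Rn n) ε := by
    refine ball_subset_ball' ?_
    rw [dist_zero_right, norm_smul, Real.norm_of_nonneg (by positivity)]
    rcases eq_or_ne w 0 with rfl | hw
    · simp; linarith
    · have : ‖w‖ ≠ 0 := norm_ne_zero_iff.2 hw
      have : ε / (2 * ‖w‖) * ‖w‖ = ε / 2 := by field_simp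
      linarith
  have hvol : volume.real (ball ((ε / (2 * ‖w‖)) • w) (ε / 4))
      = (1 / 4) ^ n * volume.real (ball (0 : Rn n) ε) := by
    have h := Measure.addHaar_ball_mul_of_pos (volume : Measure (Rn n)) ((ε / (2 * ‖w‖)) • w)
      (r := 1 / 4) (by norm_num) ε
    rw [finrank_euclideanSpace_fin] at h
    rw [measureReal_def, show ε / 4 = 1 / 4 * ε by ring, h, ENNReal.toReal_mul,
      ENNReal.toReal_ofReal (by positivity), measureReal_def]
  have hlow : ∀ y ∈ ball ((ε / (2 * ‖w‖)) • w) (ε / 4), (ε / 4 * ‖w‖) ^ 2 ≤ ⟪y, w⟫ ^ 2 := by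
    intro y hy
    rw [mem_ball, dist_eq_norm] at hy
    have h1 : ⟪y, w⟫ = ε / 2 * ‖w‖ + ⟪y - (ε / (2 * ‖w‖)) • w, w⟫ := by
      rw [inner_sub_left, real_inner_smul_left, real_inner_self_eq_norm_sq]
      rcases eq_or_ne w 0 with rfl | hw
      · simp
      · have : ‖w‖ ≠ 0 := norm_ne_zero_iff.2 hw
        field_simp
        ring
    have h2 := neg_le_of_abs_le (abs_real_inner_le_norm (y - (ε / (2 * ‖w‖)) • w) w)
    have h3 := mul_le_mul_of_nonneg_right hy.le (norm_nonneg w)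
    exact pow_le_pow_left₀ (by positivity) (by linarith) 2
  have hint : (ε / 4 * ‖w‖) ^ 2 * ((1 / 4) ^ n * volume.real (ball (0 : Rn n) ε))
      ≤ ∫ y in ball (0 : Rn n) ε, ⟪y, w⟫ ^ 2 := by
    calc _ = ∫ _ in ball ((ε / (2 * ‖w‖)) • w) (ε / 4), (ε / 4 * ‖w‖) ^ 2 := by
          rw [setIntegral_const, hvol, smul_eq_mul, mul_comm]
      _ ≤ ∫ y in ball ((ε / (2 * ‖w‖)) • w) (ε / 4), ⟪y, w⟫ ^ 2 :=
          setIntegral_mono_on (integrableOn_ball continuous_const _ _)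
            (integrableOn_ball hcont _ _) measurableSet_ball hlow
      _ ≤ _ := setIntegral_mono_set (integrableOn_ball hcont _ _)
            (Filter.Eventually.of_forall fun y => sq_nonneg _) hsub.eventuallyLE
  rw [setAverage_eq, smul_eq_mul, le_inv_mul_iff₀ hV]
  refine le_trans (le_of_eq ?_) hint
  ring

theorem integral_ball_eq_translate (f : Rn n → ℝ) (x : Rn n) :
    ∫ y in ball x ε, f y = ∫ y in ball (0 : Rn n) ε, f (x + y) := by
  have h := (measurePreserving_add_left (volume : Measure (Rn n)) x).setIntegral_preimage_emb
    (MeasurableEquiv.addLeft x).measurableEmbedding f (ball x ε)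
  rw [← h]
  congr 2
  ext y
  simp [dist_eq_norm]

theorem integral_ball_eq_reflect (f : Rn n → ℝ) (x : Rn n) :
    ∫ y in ball x ε, f y = ∫ y in ball (0 : Rn n) ε, f (x - y) := by
  have h := (Measure.measurePreserving_sub_left
    (volume : Measure (Rn n)) x).setIntegral_preimage_emb
    (MeasurableEquiv.subLeft x).measurableEmbedding f (ball x ε)
  rw [← h]
  congr 2
  ext y
  simp [dist_eq_norm]

/-- Averages over balls only see the part of a function that is symmetric about the centre. -/
theorem average_ball_le_of_symm (hε : 0 < ε) {f : Rn n → ℝ} (hf : Continuous f) {x w : Rn n}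
    {c k : ℝ} (hk : 0 ≤ k)
    (h : ∀ y ∈ ball (0 : Rn n) ε, f (x + y) + f (x - y) ≤ 2 * (c - k * ⟪y, w⟫ ^ 2)) :
    ⨍ y in ball x ε, f y ≤ c - k * ((1 / 4) ^ n / 16 * ε ^ 2 * ‖w‖ ^ 2) := by
  have hV := measureReal_ball_pos (0 : Rn n) hε
  have hVx : volume.real (ball x ε) = volume.real (ball (0 : Rn n) ε) := by
    simp only [measureReal_def, Measure.addHaar_ball_center]
  have hcont : Continuous fun y : Rn n => ⟪y, w⟫ ^ 2 := by fun_prop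
  have h1 : 2 * ∫ y in ball x ε, f y
      ≤ 2 * (c * volume.real (ball (0 : Rn n) ε) -
        k * ∫ y in ball (0 : Rn n) ε, ⟪y, w⟫ ^ 2) := by
    calc 2 * ∫ y in ball x ε, f y
        = ∫ y in ball (0 : Rn n) ε, (f (x + y) + f (x - y)) := by
          rw [integral_add (integrableOn_ball (by fun_prop) _ _)
            (integrableOn_ball (by fun_prop) _ _), ← integral_ball_eq_translate,
            ← integral_ball_eq_reflect]
          ring
      _ ≤ ∫ y in ball (0 : Rn n) ε, 2 * (c - k * ⟪y, w⟫ ^ 2) :=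
          setIntegral_mono_on (integrableOn_ball (by fun_prop) _ _)
            (integrableOn_ball (by fun_prop) _ _) measurableSet_ball h
      _ = _ := by
          rw [integral_const_mul, integral_sub (integrableOn_ball continuous_const _ _)
            ((integrableOn_ball hcont _ _).const_mul k), integral_const_mul,
            setIntegral_const, smul_eq_mul, mul_comm c]
  have h2 := mul_le_mul_of_nonneg_left (average_inner_sq_ge hε w) hk
  rw [setAverage_eq, smul_eq_mul, ← div_eq_inv_mul] at h2
  rw [setAverage_eq, smul_eq_mul, ← div_eq_inv_mul, hVx]
  have h3 : (∫ y in ball x ε, f y) / volume.real (ball (0 : Rn n) ε)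
      ≤ c - k * ((∫ y in ball (0 : Rn n) ε, ⟪y, w⟫ ^ 2) / volume.real (ball (0 : Rn n) ε)) := by
    rw [div_le_iff₀ hV, sub_mul, mul_assoc k, div_mul_cancel₀ _ hV.ne']
    linarith
  linarith

/-- The infimum is estimated by one chosen move `q`, the supremum by a crude bound `U`, and the mean
by the second differences of `f`. -/
theorem tugAverage_le (hp : 2 ≤ p) (hε : 0 < ε) {f : Rn n → ℝ} (hf : Continuous f)
    {x q w : Rn n} {U c k : ℝ} (hU : ∀ y ∈ ball x ε, f y ≤ U) (hq : dist q x ≤ ε) (hk : 0 ≤ k)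
    (h : ∀ y ∈ ball (0 : Rn n) ε, f (x + y) + f (x - y) ≤ 2 * (c - k * ⟪y, w⟫ ^ 2)) :
    tugAverage p ε f x ≤ tugWeight n p * ((U + f q) / 2) +
      noiseWeight n p * (c - k * ((1 / 4) ^ n / 16 * ε ^ 2 * ‖w‖ ^ 2)) := by
  have h1 : sSup (f '' ball x ε) ≤ U := by
    refine csSup_le ⟨_, mem_image_of_mem f (mem_ball_self hε)⟩ ?_
    rintro _ ⟨y, hy, rfl⟩
    exact hU y hy
  have h2 := sInf_image_ball_le hε hf hq
  have h3 := average_ball_le_of_symm hε hf hk h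
  have h4 := mul_le_mul_of_nonneg_left (add_le_add h1 h2) (tugWeight_nonneg n hp)
  have h5 := mul_le_mul_of_nonneg_left h3 (noiseWeight_nonneg n hp)
  unfold tugAverage
  linarith

/-- A bound for both the average of the extreme values and the symmetric part of `f` bounds the
whole tug-of-war average. -/
theorem tugAverage_le_of_le (hp : 2 ≤ p) (hε : 0 < ε) {f : Rn n → ℝ} (hf : Continuous f)
    {x q w : Rn n} {U c k B : ℝ} (hU : ∀ y ∈ ball x ε, f y ≤ U) (hq : dist q x ≤ ε) (hk : 0 ≤ k)
    (h : ∀ y ∈ ball (0 : Rn n) ε, f (x + y) + f (x - y) ≤ 2 * (c - k * ⟪y, w⟫ ^ 2))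
    (hB : (U + f q) / 2 ≤ B) (hB' : c - k * ((1 / 4) ^ n / 16 * ε ^ 2 * ‖w‖ ^ 2) ≤ B) :
    tugAverage p ε f x ≤ B := by
  have h1 := tugAverage_le hp hε hf hU hq hk h
  have h2 := mul_le_mul_of_nonneg_left hB (tugWeight_nonneg n hp)
  have h3 := mul_le_mul_of_nonneg_left hB' (noiseWeight_nonneg n hp)
  have h4 := tugWeight_add_noiseWeight n hp
  have h5 : tugWeight n p * B + noiseWeight n p * B = B := by rw [← add_mul, h4, one_mul]
  linarith

end TugAverage

/-! ### Comparison with continuous supersolutions. -/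

section Comparison

variable {n : ℕ} {p T ε : ℝ} {Ω : Set (Rn n)}

/-- From outside `Ω`, the distance to `Ω` is attained at a frontier point. -/
theorem mem_boundaryStrip_of_dist_le {x y : Rn n} (hx : x ∈ Ω) (hy : y ∉ Ω)
    (h : dist y x ≤ ε) : y ∈ boundaryStrip Ω ε := by
  refine ⟨hy, ?_⟩
  obtain ⟨b, hb, hyb⟩ := exists_mem_frontier_infDist_compl_eq_dist (s := Ωᶜ) (x := y) hy
    (fun h => (h.symm ▸ mem_univ x : x ∈ Ωᶜ) hx)
  rw [frontier_compl] at hb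
  rw [compl_compl] at hyb
  calc infDist y (frontier Ω) ≤ dist y b := infDist_le_dist_of_mem hb
    _ = infDist y Ω := hyb.symm
    _ ≤ dist y x := infDist_le_dist_of_mem hx
    _ ≤ ε := h

theorem mem_region_of_mem_ball (hε : 0 < ε) {x y : Rn n} {t : ℝ}
    (hx : (x, t) ∈ spaceTimeCylinder Ω T) (hy : y ∈ ball x ε) :
    (y, t - ε ^ 2 / 2) ∈ spaceTimeCylinder Ω T ∪ parabolicStrip Ω T ε := by
  obtain ⟨hxΩ, ht0, htT⟩ := hx
  dsimp only at hxΩ ht0 htT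
  have : 0 < ε ^ 2 := by positivity
  by_cases hyΩ : y ∈ Ω
  · rcases lt_or_ge 0 (t - ε ^ 2 / 2) with h | h
    · exact Or.inl ⟨hyΩ, h, by dsimp only; linarith⟩
    · exact Or.inr (Or.inr ⟨hyΩ, by dsimp only; linarith, h⟩)
  · exact Or.inr (Or.inl ⟨mem_boundaryStrip_of_dist_le hxΩ hyΩ (mem_ball.1 hy).le,
      by dsimp only; linarith, by dsimp only; linarith⟩)

theorem integrableOn_slice {v : Rn n × ℝ → ℝ} {A : Set (Rn n × ℝ)}
    (hv : Measurable (A.domRestrict v)) {M : ℝ} (hM : ∀ q ∈ A, |v q| ≤ M) {x : Rn n} {s : ℝ}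
    (hA : ∀ y ∈ ball x ε, (y, s) ∈ A) :
    IntegrableOn (fun y => v (y, s)) (ball x ε) := by
  have hmeas : AEMeasurable (fun y => v (y, s)) (volume.restrict (ball x ε)) := by
    refine aemeasurable_restrict_of_measurable_subtype measurableSet_ball ?_
    have hg : Measurable fun y : ball x ε => (⟨(y.1, s), hA y.1 y.2⟩ : A) :=
      Measurable.subtype_mk (by fun_prop)
    exact hv.comp hg
  have : IsFiniteMeasure (volume.restrict (ball x ε)) := ⟨by
    rw [Measure.restrict_apply_univ]; exact measure_ball_lt_top⟩
  refine Integrable.of_bound hmeas.aestronglyMeasurable M ?_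
  filter_upwards [ae_restrict_mem measurableSet_ball] with y hy
  exact hM _ (hA y hy)

/-- Comparison principle: a bounded Borel function which satisfies the dynamic programming
inequality wherever it is not yet below `w` stays below the supersolution `w`. -/
theorem le_of_supersolution (hp : 2 ≤ p) (hε : 0 < ε) {v w : Rn n × ℝ → ℝ} {t₀ M : ℝ}
    (hv : Measurable ((spaceTimeCylinder Ω T ∪ parabolicStrip Ω T ε).domRestrict v))
    (hM : ∀ q ∈ spaceTimeCylinder Ω T ∪ parabolicStrip Ω T ε, |v q| ≤ M)
    (hw : ∀ t, Continuous fun y => w (y, t))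
    (hΓ : ∀ q ∈ parabolicStrip Ω T ε, q.2 ≤ t₀ → v q ≤ w q)
    (hsub : ∀ x t, (x, t) ∈ spaceTimeCylinder Ω T → t ≤ t₀ →
      v (x, t) ≤ w (x, t) ∨ v (x, t) ≤ tugAverage p ε (fun y => v (y, t - ε ^ 2 / 2)) x)
    (hsuper : ∀ x t, (x, t) ∈ spaceTimeCylinder Ω T → t ≤ t₀ →
      tugAverage p ε (fun y => w (y, t - ε ^ 2 / 2)) x ≤ w (x, t))
    {q : Rn n × ℝ} (hq : q ∈ spaceTimeCylinder Ω T ∪ parabolicStrip Ω T ε) (hqt : q.2 ≤ t₀) :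
    v q ≤ w q := by
  have hε2 : 0 < ε ^ 2 / 2 := by positivity
  -- Each round lowers the time by `ε² / 2`, so induction runs over time layers of that height. In
  -- the base layer only strip points occur, because cylinder times are positive.
  have key : ∀ k : ℕ, ∀ q ∈ spaceTimeCylinder Ω T ∪ parabolicStrip Ω T ε,
      q.2 ≤ t₀ → q.2 ≤ k * (ε ^ 2 / 2) → v q ≤ w q := by
    intro k
    induction k with
    | zero =>
      rintro q (hq | hq) ht hk
      · rw [Nat.cast_zero, zero_mul] at hk
        exact absurd hq.2.1 (not_lt.2 hk)
      · exact hΓ q hq ht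
    | succ k ih =>
      rintro ⟨x, t⟩ (hq | hq) ht hk
      · refine (hsub x t hq ht).elim id fun h => h.trans (le_trans ?_ (hsuper x t hq ht))
        have hA : ∀ y ∈ ball x ε, (y, t - ε ^ 2 / 2) ∈
          spaceTimeCylinder Ω T ∪ parabolicStrip Ω T ε := fun y hy =>
            mem_region_of_mem_ball hε hq hy
        refine tugAverage_mono hp hε (integrableOn_slice hv hM hA)
          (integrableOn_ball (hw _) _ _) ?_ (bddAbove_image_ball (hw _) _ _) fun y hy => ?_
        · refine ⟨-M, ?_⟩
          rintro _ ⟨y, hy, rfl⟩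
          exact neg_le_of_abs_le (hM _ (hA y hy))
        · refine ih _ (hA y hy) ?_ ?_
          · dsimp only at ht ⊢
            linarith
          · push_cast at hk
            dsimp only at hk ⊢
            linarith
      · exact hΓ _ hq ht
  obtain ⟨k, hk⟩ := exists_nat_ge (q.2 / (ε ^ 2 / 2))
  exact key k q hq hqt ((div_le_iff₀ hε2).1 hk)

end Comparison

/-! ### Radial supersolutions in space. -/

section Barriers

variable {n : ℕ} {p ε δ : ℝ}

/-- This is `cosh t = 1 + 2 sinh² (t / 2)` together with `|s| ≤ |sinh s|`. -/
theorem two_add_sq_le_exp_add_exp_neg (t : ℝ) :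
    2 + t ^ 2 ≤ Real.exp t + Real.exp (-t) := by
  have h1 : Real.cosh t = Real.cosh (2 * (t / 2)) := by congr 1; ring
  rw [Real.cosh_two_mul, Real.cosh_sq] at h1
  have h2 : (t / 2) ^ 2 ≤ Real.sinh (t / 2) ^ 2 := by
    rw [sq_le_sq, Real.abs_sinh]
    exact Real.self_le_sinh_iff.2 (abs_nonneg _)
  have h3 : Real.cosh t * 2 = Real.exp t + Real.exp (-t) := by
    rw [Real.cosh_eq]; ring
  linarith

/-- With `a = |x - z|²`, `q = |y|²`, `s = ⟪y, x - z⟫`, the exponents contain `|x ± y - z|²`. The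
term `l² s²` is the convexity gain that must beat the loss `l q`. -/
theorem le_exp_add_exp {l : ℝ} {a q s : ℝ} (hq : l * q ≤ 1 / 2) :
    2 * (Real.exp (-(l * a)) * (1 - l * q + l ^ 2 * s ^ 2)) ≤
      Real.exp (-(l * (a + 2 * s + q))) + Real.exp (-(l * (a - 2 * s + q))) := by
  have h1 : Real.exp (-(l * (a + 2 * s + q))) + Real.exp (-(l * (a - 2 * s + q))) =
      Real.exp (-(l * a)) * (Real.exp (-(l * q)) *
        (Real.exp (2 * l * s) + Real.exp (-(2 * l * s)))) := by
    rw [show -(l * (a + 2 * s + q)) = -(l * a) + (-(l * q) + -(2 * l * s)) by ring,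
      show -(l * (a - 2 * s + q)) = -(l * a) + (-(l * q) + 2 * l * s) by ring,
      Real.exp_add, Real.exp_add, Real.exp_add, Real.exp_add]
    ring
  rw [h1, mul_left_comm]
  refine mul_le_mul_of_nonneg_left ?_ (Real.exp_pos _).le
  have h2 := two_add_sq_le_exp_add_exp_neg (2 * l * s)
  have h3 : 1 - l * q ≤ Real.exp (-(l * q)) := by
    have := Real.add_one_le_exp (-(l * q)); linarith
  calc 2 * (1 - l * q + l ^ 2 * s ^ 2)
      ≤ (1 - l * q) * (2 + (2 * l * s) ^ 2) := by
        nlinarith [mul_nonneg (sub_nonneg.2 hq) (sq_nonneg (l * s))]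
    _ ≤ _ := by
        gcongr

theorem dist_sq_add_sub (x y z : Rn n) :
    dist (x + y) z ^ 2 = dist x z ^ 2 + 2 * ⟪y, x - z⟫ + ‖y‖ ^ 2 := by
  rw [dist_eq_norm, dist_eq_norm, show x + y - z = (x - z) + y by abel, norm_add_sq_real,
    real_inner_comm]

theorem dist_sq_sub_sub (x y z : Rn n) :
    dist (x - y) z ^ 2 = dist x z ^ 2 - 2 * ⟪y, x - z⟫ + ‖y‖ ^ 2 := by
  rw [sub_eq_add_neg, dist_sq_add_sub, norm_neg, inner_neg_left]
  ring

/-- The squared distances add up by the parallelogram law; AM-GM against `dist x z` removes the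
squares, and `δ` bounds the curvature. -/
theorem dist_add_dist_sub_le {x z : Rn n} (hδ : 0 < δ) (hx : δ ≤ dist x z) {y : Rn n}
    (hy : ‖y‖ ≤ ε) :
    dist (x + y) z + dist (x - y) z ≤ 2 * (dist x z + ε ^ 2 / (2 * δ)) := by
  have ha : 0 < dist x z := hδ.trans_le hx
  have h1 := dist_sq_add_sub x y z
  have h2 := dist_sq_sub_sub x y z
  have h3 : ‖y‖ ^ 2 ≤ ε ^ 2 := pow_le_pow_left₀ (norm_nonneg y) hy 2
  have h4 : dist x z * (dist (x + y) z + dist (x - y) z) ≤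
      dist x z * (2 * dist x z) + ε ^ 2 := by
    nlinarith [sq_nonneg (dist (x + y) z - dist x z), sq_nonneg (dist (x - y) z - dist x z)]
  have h5 : ε ^ 2 ≤ dist x z * (ε ^ 2 / δ) := by
    calc ε ^ 2 = δ * (ε ^ 2 / δ) := by field_simp
      _ ≤ _ := by gcongr
  have h6 : 2 * (dist x z + ε ^ 2 / (2 * δ)) = 2 * dist x z + ε ^ 2 / δ := by
    field_simp
  rw [h6]
  refine le_of_mul_le_mul_left ?_ ha
  linarith

/-- Moving from `x` straight towards `z`. -/
theorem exists_dist_eq_of_le {x z : Rn n} (hx : 0 < dist x z) {r : ℝ} (hr : 0 ≤ r)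
    (hrx : r ≤ dist x z) : ∃ q : Rn n, dist q x = r ∧ dist q z = dist x z - r := by
  have hn : ‖x - z‖ = dist x z := (dist_eq_norm x z).symm
  refine ⟨x - (r / dist x z) • (x - z), ?_, ?_⟩
  · rw [dist_eq_norm, sub_sub_cancel_left, norm_neg, norm_smul, hn,
      Real.norm_of_nonneg (by positivity)]
    field_simp
  · have : x - (r / dist x z) • (x - z) - z = (1 - r / dist x z) • (x - z) := by
      rw [sub_smul, one_smul]; abel
    rw [dist_eq_norm, this, norm_smul, hn, Real.norm_of_nonneg]
    · field_simp
    · rw [sub_nonneg, div_le_one hx]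
      exact hrx

theorem tugAverage_dist_le (hp : 2 ≤ p) (hε : 0 < ε) (hδ : 0 < δ) {x z : Rn n}
    (hx : δ ≤ dist x z) (c : ℝ) :
    tugAverage p ε (fun y => dist y z + c) x ≤ dist x z + c + ε ^ 2 / δ := by
  have ha : 0 < dist x z := hδ.trans_le hx
  have hcont : Continuous fun y : Rn n => dist y z + c := by fun_prop
  have hU : ∀ y ∈ ball x ε, dist y z + c ≤ dist x z + ε + c := fun y hy => by
    have := dist_triangle y x z
    have := mem_ball.1 hy
    linarith
  have hsymm : ∀ y ∈ ball (0 : Rn n) ε, (dist (x + y) z + c) + (dist (x - y) z + c) ≤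
      2 * ((dist x z + ε ^ 2 / (2 * δ) + c) - 0 * ⟪y, (0 : Rn n)⟫ ^ 2) := fun y hy => by
    have := dist_add_dist_sub_le hδ hx (mem_ball_zero_iff.1 hy).le
    linarith
  have hle : ε ^ 2 / (2 * δ) ≤ ε ^ 2 / δ := by
    gcongr
    linarith
  have hpos : 0 ≤ ε ^ 2 / δ := by positivity
  rcases le_or_gt ε (dist x z) with h | h
  · obtain ⟨q, hqx, hqz⟩ := exists_dist_eq_of_le ha hε.le h
    refine tugAverage_le_of_le hp hε hcont hU hqx.le le_rfl hsymm ?_ ?_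
    · rw [hqz]; linarith
    · linarith
  -- If `z` itself is within reach then `δ < ε`, so even a full step is absorbed by the error term.
  · have h1 : ε ≤ ε ^ 2 / δ := by
      rw [le_div_iff₀ hδ]
      nlinarith
    refine tugAverage_le_of_le hp hε hcont hU (q := z) (by rw [dist_comm]; exact h.le) le_rfl
      hsymm ?_ ?_
    · rw [dist_self]; linarith
    · linarith

/-- For small steps a concave radial function is a strict supersolution away from its centre. -/
theorem tugAverage_dist_sub_exp_le (hp : 2 ≤ p) (hε : 0 < ε) (hδ : 0 < δ) (hεδ : ε ≤ δ)
    {x z : Rn n} (hx : δ ≤ dist x z) {l D : ℝ} (hD : 0 ≤ D)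
    (hl : 2 ≤ l * ((1 / 4) ^ n / 16 * δ ^ 2)) (hlε : l * ε ^ 2 ≤ 1 / 2) (c : ℝ) :
    tugAverage p ε (fun y => dist y z - D * Real.exp (-(l * dist y z ^ 2)) + c) x ≤
      dist x z - D * Real.exp (-(l * dist x z ^ 2)) + c + ε ^ 2 / (2 * δ) -
        D * Real.exp (-(l * dist x z ^ 2)) * (l * ε ^ 2) := by
  have ha : 0 < dist x z := hδ.trans_le hx
  set m : ℝ := (1 / 4) ^ n / 16 with hm
  have hm0 : 0 < m := by positivity
  have hm1 : m ≤ 1 := by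
    have : ((1 : ℝ) / 4) ^ n ≤ 1 := pow_le_one₀ (by norm_num) (by norm_num)
    linarith
  have hl0 : 0 < l := pos_of_mul_pos_left (two_pos.trans_le hl) (by positivity)
  set a := dist x z with ha'
  set e := Real.exp (-(l * a ^ 2)) with he
  have he0 : 0 < e := Real.exp_pos _
  have hla : 2 ≤ l * (m * a ^ 2) := hl.trans (by gcongr)
  -- The factor 2 in `hla` and `hla'` makes the convexity gain at least twice the loss `l * ε ^ 2`,
  -- in the noise and the tug part respectively.
  have hla' : 2 ≤ l * a ^ 2 := hla.trans (by
    gcongr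
    exact mul_le_of_le_one_left (sq_nonneg a) hm1)
  have hpos : 0 ≤ ε ^ 2 / (2 * δ) := by positivity
  have hDe : 0 ≤ D * e := mul_nonneg hD he0.le
  obtain ⟨q, hqx, hqz⟩ := exists_dist_eq_of_le ha hε.le (hεδ.trans hx)
  refine tugAverage_le_of_le hp hε (by fun_prop) (q := q) (w := x - z)
    (U := a + ε - D * Real.exp (-(l * (a + ε) ^ 2)) + c)
    (c := a + ε ^ 2 / (2 * δ) - D * e * (1 - l * ε ^ 2) + c) (k := D * e * l ^ 2)
    (fun y hy => ?_) hqx.le (by positivity) (fun y hy => ?_) ?_ ?_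
  · have h1 : dist y z ≤ a + ε := by
      have := dist_triangle y x z
      have := mem_ball.1 hy
      linarith
    gcongr
  · have hyε := (mem_ball_zero_iff.1 hy).le
    have hy2 : ‖y‖ ^ 2 ≤ ε ^ 2 := pow_le_pow_left₀ (norm_nonneg y) hyε 2
    have h1 := dist_add_dist_sub_le hδ hx hyε
    have h2 := le_exp_add_exp (l := l) (a := a ^ 2) (q := ‖y‖ ^ 2) (s := ⟪y, x - z⟫)
      ((mul_le_mul_of_nonneg_left hy2 hl0.le).trans hlε)
    rw [← dist_sq_add_sub, ← dist_sq_sub_sub] at h2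
    have h3 := mul_le_mul_of_nonneg_left h2 hD
    have h4 := mul_le_mul_of_nonneg_left (mul_le_mul_of_nonneg_left hy2 hl0.le) hDe
    simp only [← he] at h3
    linarith
  · rw [hqz]
    -- The tug term is the radial case of the same inequality: the extreme distances are `a ± ε`.
    have h2 := le_exp_add_exp (l := l) (a := a ^ 2) (q := ε ^ 2) (s := a * ε) hlε
    rw [show a ^ 2 + 2 * (a * ε) + ε ^ 2 = (a + ε) ^ 2 by ring,
      show a ^ 2 - 2 * (a * ε) + ε ^ 2 = (a - ε) ^ 2 by ring] at h2
    have h3 := mul_le_mul_of_nonneg_left h2 hD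
    have h4 := mul_le_mul_of_nonneg_left hla' (show 0 ≤ D * e * (l * ε ^ 2) by positivity)
    simp only [← he] at h3
    linarith
  · have h4 := mul_le_mul_of_nonneg_left hla (show 0 ≤ D * e * (l * ε ^ 2) by positivity)
    rw [← dist_eq_norm, ← ha', ← hm]
    linarith

/-- The concave paraboloid is a strict supersolution at every scale. -/
theorem tugAverage_const_sub_dist_sq_le (hp : 2 ≤ p) (hε : 0 < ε) {x z : Rn n} (hx : x ≠ z)
    {D : ℝ} (hD : 0 ≤ D) (c : ℝ) :
    tugAverage p ε (fun y => c - D * dist y z ^ 2) x ≤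
      c - D * dist x z ^ 2 - D * ((1 / 4) ^ n / 16 * ε ^ 2) := by
  have ha : 0 < dist x z := dist_pos.2 hx
  set m : ℝ := (1 / 4) ^ n / 16 with hm
  have hm1 : m ≤ 1 / 2 := by
    have : ((1 : ℝ) / 4) ^ n ≤ 1 := pow_le_one₀ (by norm_num) (by norm_num)
    linarith
  have hm0 : 0 < m := by positivity
  set a := dist x z with ha'
  set r := max (a - ε) 0 with hr
  have hr0 : 0 ≤ r := le_max_right _ _
  -- Here `r` is a lower bound for the distance to `z` on the ball, and the minimizing player pulls
  -- away from `z` to distance `a + ε`.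
  have hkey : 2 * a ^ 2 + ε ^ 2 ≤ r ^ 2 + (a + ε) ^ 2 := by
    rcases le_total ε a with h | h
    · rw [hr, max_eq_left (by linarith)]
      nlinarith [sq_nonneg ε]
    · rw [hr, max_eq_right (by linarith)]
      nlinarith
  have hn : ‖x - z‖ = a := (dist_eq_norm x z).symm
  set w : Rn n := a⁻¹ • (x - z) with hw
  have hw1 : ‖w‖ = 1 := by
    rw [hw, norm_smul, hn, Real.norm_of_nonneg (by positivity), inv_mul_cancel₀ ha.ne']
  refine tugAverage_le_of_le hp hε (by fun_prop) (q := x + ε • w) (w := w)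
    (U := c - D * r ^ 2) (c := c - D * a ^ 2) (k := D)
    (fun y hy => ?_) ?_ hD (fun y hy => ?_) ?_ ?_
  · have h1 : r ≤ dist y z := by
      refine max_le ?_ dist_nonneg
      have := dist_triangle x y z
      have := mem_ball'.1 hy
      linarith
    gcongr
  · rw [dist_eq_norm, add_sub_cancel_left, norm_smul, hw1, Real.norm_of_nonneg hε.le, mul_one]
  · have h1 : ⟪y, w⟫ ^ 2 ≤ ‖y‖ ^ 2 := by
      have := abs_real_inner_le_norm y w
      rw [hw1, mul_one] at this
      exact sq_le_sq.2 (this.trans (le_abs_self _))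
    have h2 := mul_le_mul_of_nonneg_left h1 hD
    rw [dist_sq_add_sub, dist_sq_sub_sub]
    linarith
  · have h1 : dist (x + ε • w) z = a + ε := by
      have h2 : x + ε • w - z = (1 + ε * a⁻¹) • (x - z) := by
        rw [add_smul, one_smul, hw, smul_smul]; abel
      rw [dist_eq_norm, h2, norm_smul, hn, Real.norm_of_nonneg (by positivity)]
      field_simp
    rw [h1]
    have h2 := mul_le_mul_of_nonneg_left hkey hD
    have h3 := mul_le_mul_of_nonneg_left (mul_le_mul_of_nonneg_right hm1 (sq_nonneg ε)) hD
    linarith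
  · rw [hw1, ← hm]
    linarith

end Barriers

/-! ### Space-time barriers and their size at the starting point. -/

section Estimates

variable {n : ℕ} {p T ε δ : ℝ} {Ω : Set (Rn n)}

theorem sqrt_add_le_sqrt_add_sqrt (a b : ℝ) :
    Real.sqrt (a + b) ≤ Real.sqrt a + Real.sqrt b := by
  have ha := Real.sqrt_nonneg a
  have hb := Real.sqrt_nonneg b
  refine (Real.sqrt_le_left (by positivity)).2 ?_
  nlinarith [Real.sq_sqrt' (x := a), Real.sq_sqrt' (x := b), le_max_left a 0,
    le_max_left b 0, mul_nonneg ha hb]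

/-- A supersolution of the dynamic programming principle up to time `t₀` which dominates the
parabolic distance to `(z, t₀)`. -/
structure IsParabolicBarrier (p : ℝ) (Ω : Set (Rn n)) (T ε : ℝ) (z : Rn n) (t₀ : ℝ)
    (W : Rn n × ℝ → ℝ) : Prop where
  continuous_slice : ∀ t, Continuous fun y => W (y, t)
  dist_add_sqrt_le : ∀ q ∈ spaceTimeCylinder Ω T ∪ parabolicStrip Ω T ε, q.2 ≤ t₀ →
    dist q.1 z + Real.sqrt (t₀ - q.2) ≤ W q
  tugAverage_le : ∀ x t, (x, t) ∈ spaceTimeCylinder Ω T → t ≤ t₀ →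
    tugAverage p ε (fun y => W (y, t - ε ^ 2 / 2)) x ≤ W (x, t)

/-- The triangle inequality through `(z, t₀)` makes `L * W` plus a constant dominate all increments
of `F` and `ψ` from `(y, ty)`; comparison is then applied to `u` and to `-u`. -/
theorem IsParabolicBarrier.abs_sub_le {C₁ C₂ L ρ t₀ ty : ℝ} {F ψ u W : Rn n × ℝ → ℝ}
    {x y z : Rn n} (hW : IsParabolicBarrier p Ω T ε z t₀ W) (hp : 2 ≤ p) (hε : 0 < ε)
    (hL : 0 ≤ L) (hC₁ : C₁ ≤ L) (hC₂ : C₂ ≤ L)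
    (hF : ParabolicLipschitzOn C₁ F (parabolicStrip Ω T ε))
    (hψ : ParabolicLipschitzOn C₂ ψ univ)
    (hψF : ∀ q ∈ parabolicStrip Ω T ε, ψ q ≤ F q)
    (hu : IsObstacleDPPSolution p Ω T ε F ψ u)
    (hx : (x, t₀) ∈ spaceTimeCylinder Ω T) (hy : (y, ty) ∈ parabolicStrip Ω T ε)
    (hyz : dist y z ≤ ρ) :
    |u (x, t₀) - u (y, ty)| ≤ L * (W (x, t₀) + ρ + Real.sqrt |t₀ - ty|) := by
  obtain ⟨M, hM⟩ := hu.bounded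
  have huy := hu.boundary _ hy
  have hdist : ∀ q ∈ spaceTimeCylinder Ω T ∪ parabolicStrip Ω T ε, q.2 ≤ t₀ →
      dist q.1 y + Real.sqrt |q.2 - ty| ≤ W q + ρ + Real.sqrt |t₀ - ty| := by
    intro q hq hqt
    have h1 := hW.dist_add_sqrt_le q hq hqt
    have h2 := dist_triangle_right q.1 y z
    have h3 : Real.sqrt |q.2 - ty| ≤ Real.sqrt (t₀ - q.2) + Real.sqrt |t₀ - ty| := by
      refine (Real.sqrt_le_sqrt ?_).trans (sqrt_add_le_sqrt_add_sqrt _ _)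
      calc |q.2 - ty| ≤ |q.2 - t₀| + |t₀ - ty| := _root_.abs_sub_le _ _ _
        _ = t₀ - q.2 + |t₀ - ty| := by rw [abs_sub_comm, abs_of_nonneg (by linarith)]
    linarith
  have hdist' : ∀ {K : ℝ}, K ≤ L → ∀ q ∈ spaceTimeCylinder Ω T ∪ parabolicStrip Ω T ε,
      q.2 ≤ t₀ → K * (dist q.1 y + Real.sqrt |q.2 - ty|) ≤
        L * (ρ + Real.sqrt |t₀ - ty|) + L * W q := by
    intro K hK q hq hqt
    have h1 := mul_le_mul_of_nonneg_left (hdist q hq hqt) hL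
    have h2 := mul_le_mul_of_nonneg_right hK
      (add_nonneg (dist_nonneg (x := q.1) (y := y)) (Real.sqrt_nonneg |q.2 - ty|))
    linarith
  have hcont : ∀ c t, Continuous fun y => c + L * W (y, t) := fun c t =>
    continuous_const.add (continuous_const.mul (hW.continuous_slice t))
  have hsuper : ∀ c, ∀ ξ t, (ξ, t) ∈ spaceTimeCylinder Ω T → t ≤ t₀ →
      tugAverage p ε (fun y => c + L * W (y, t - ε ^ 2 / 2)) ξ ≤ c + L * W (ξ, t) := by
    intro c ξ t hξ ht
    rw [tugAverage_const_add_mul hp hε c hL (hW.continuous_slice _)]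
    have := mul_le_mul_of_nonneg_left (hW.tugAverage_le ξ t hξ ht) hL
    linarith
  have upper : u (x, t₀) ≤ (u (y, ty) + L * (ρ + Real.sqrt |t₀ - ty|)) + L * W (x, t₀) := by
    refine le_of_supersolution (v := u)
      (w := fun q => (u (y, ty) + L * (ρ + Real.sqrt |t₀ - ty|)) + L * W q) (t₀ := t₀)
      hp hε hu.borel hM (hcont _) (fun q hq hqt => ?_) (fun ξ t hξ ht => ?_) (hsuper _)
      (Or.inl hx) le_rfl
    · have h1 := (abs_le.1 (hF q hq _ hy)).2
      have h2 := hdist' hC₁ q (Or.inr hq) hqt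
      have h3 := hu.boundary q hq
      linarith
    · rw [hu.dpp ξ t hξ]
      -- Where the obstacle is active, `u` is already below the barrier, since `ψ (y, ty) ≤ F (y,
      -- ty) = u (y, ty)`.
      rcases le_total (ψ (ξ, t)) (tugAverage p ε (fun y => u (y, t - ε ^ 2 / 2)) ξ) with h | h
      · exact Or.inr (max_le h le_rfl)
      · refine Or.inl (max_le ?_ (h.trans ?_)) <;>
        · have h1 := (abs_le.1 (hψ (ξ, t) (mem_univ _) (y, ty) (mem_univ _))).2
          have h2 := hdist' hC₂ (ξ, t) (Or.inl hξ) ht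
          have h3 := hψF _ hy
          linarith
  have lower : -u (x, t₀) ≤ (-u (y, ty) + L * (ρ + Real.sqrt |t₀ - ty|)) + L * W (x, t₀) := by
    refine le_of_supersolution (v := fun q => -u q)
      (w := fun q => (-u (y, ty) + L * (ρ + Real.sqrt |t₀ - ty|)) + L * W q) (t₀ := t₀) (M := M)
      hp hε hu.borel.neg (fun q hq => by rw [abs_neg]; exact hM q hq) (hcont _)
      (fun q hq hqt => ?_) (fun ξ t hξ ht => Or.inr ?_) (hsuper _) (Or.inl hx) le_rfl
    · have h1 := (abs_le.1 (hF q hq _ hy)).1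
      have h2 := hdist' hC₁ q (Or.inr hq) hqt
      have h3 := hu.boundary q hq
      linarith
    · rw [tugAverage_neg, hu.dpp ξ t hξ]
      exact neg_le_neg (le_max_right _ _)
  rw [abs_le]
  constructor <;> linarith

theorem neg_lt_snd_of_mem_region (hε : 0 < ε) {q : Rn n × ℝ}
    (hq : q ∈ spaceTimeCylinder Ω T ∪ parabolicStrip Ω T ε) : -(ε ^ 2 / 2) < q.2 := by
  have : 0 < ε ^ 2 / 2 := by positivity
  rcases hq with hq | hq | hq
  · linarith [hq.2.1]
  · exact hq.2.1
  · exact hq.2.1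

theorem fst_mem_of_mem_region {q : Rn n × ℝ}
    (hq : q ∈ spaceTimeCylinder Ω T ∪ parabolicStrip Ω T ε) :
    q.1 ∈ Ω ∪ boundaryStrip Ω ε := by
  rcases hq with hq | hq | hq
  · exact Or.inl hq.1
  · exact Or.inr hq.1
  · exact Or.inl hq.1

/-- Barrier whose cost is controlled by the elapsed time. -/
theorem isParabolicBarrier_elapsedTime (hp : 2 ≤ p) (hε : 0 < ε) (hδ : 0 < δ) {z : Rn n} {t₀ : ℝ}
    (hΩ : ∀ ξ ∈ Ω, δ ≤ dist ξ z) :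
    IsParabolicBarrier p Ω T ε z t₀ fun q =>
      dist q.1 z + (2 / δ * (q.2 + ε ^ 2 / 2) + (Real.sqrt t₀ + ε)) where
  continuous_slice t := by fun_prop
  dist_add_sqrt_le q hq hqt := by
    have h1 := neg_lt_snd_of_mem_region hε hq
    have h2 : Real.sqrt (t₀ - q.2) ≤ Real.sqrt t₀ + ε := by
      rcases le_total 0 t₀ with h | h
      · calc Real.sqrt (t₀ - q.2) ≤ Real.sqrt (t₀ + ε ^ 2) :=
            Real.sqrt_le_sqrt (by linarith [sq_nonneg ε])
          _ ≤ Real.sqrt t₀ + Real.sqrt (ε ^ 2) := sqrt_add_le_sqrt_add_sqrt _ _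
          _ = _ := by rw [Real.sqrt_sq hε.le]
      · have h3 : Real.sqrt (t₀ - q.2) ≤ ε := by
          rw [← Real.sqrt_sq hε.le]
          exact Real.sqrt_le_sqrt (by linarith [sq_nonneg ε])
        linarith [Real.sqrt_nonneg t₀]
    have h3 : 0 ≤ 2 / δ * (q.2 + ε ^ 2 / 2) := mul_nonneg (by positivity) (by linarith)
    linarith
  tugAverage_le x t hx ht := by
    dsimp only
    -- The slope `2 / δ` over a time step `ε² / 2` compensates the drift `ε² / δ` exactly.
    refine (tugAverage_dist_le hp hε hδ (hΩ x hx.1) _).trans (le_of_eq ?_)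
    field_simp
    ring

/-- AM-GM. The majorant is linear in `s`, so each round changes it by a fixed amount. -/
theorem sqrt_le_half_add_div {μ s : ℝ} (hμ : 0 < μ) (hs : 0 ≤ s) :
    Real.sqrt s ≤ μ / 2 + s / (2 * μ) := by
  have h : μ / 2 + s / (2 * μ) = (μ ^ 2 + s) / (2 * μ) := by field_simp
  rw [h, le_div_iff₀ (by positivity)]
  nlinarith [sq_nonneg (Real.sqrt s - μ), Real.sq_sqrt hs]

/-- Barrier for small steps, built on the expected exit time when pulling towards `z`. -/
theorem isParabolicBarrier_exp (hp : 2 ≤ p) (hε : 0 < ε) (hδ : 0 < δ) (hεδ : ε ≤ δ)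
    {z : Rn n} {t₀ r μ l D : ℝ} (hΩ : ∀ ξ ∈ Ω, δ ≤ dist ξ z) (hΩr : ∀ ξ ∈ Ω, dist ξ z ≤ r)
    (hS : ∀ ξ ∈ boundaryStrip Ω ε, δ - ε ≤ dist ξ z) (hμ : 0 < μ) (hD : 0 ≤ D)
    (hl : 2 ≤ l * ((1 / 4) ^ n / 16 * δ ^ 2)) (hlε : l * ε ^ 2 ≤ 1 / 2)
    (hDl : 1 / (4 * μ) + 1 / (2 * δ) ≤ D * (l * Real.exp (-(l * r ^ 2)))) :
    IsParabolicBarrier p Ω T ε z t₀ fun q =>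
      dist q.1 z - D * Real.exp (-(l * dist q.1 z ^ 2)) +
        (D * Real.exp (-(l * (δ - ε) ^ 2)) + μ / 2 + (t₀ - q.2) / (2 * μ)) := by
  have hl0 : 0 < l := pos_of_mul_pos_left (two_pos.trans_le hl) (by positivity)
  refine ⟨fun t => by fun_prop, fun q hq hqt => ?_, fun x t hx ht => ?_⟩
  · have h1 := sqrt_le_half_add_div hμ (sub_nonneg.2 hqt)
    have h2 : δ - ε ≤ dist q.1 z := (fst_mem_of_mem_region hq).elim
      (fun h => by linarith [hΩ _ h]) (hS _)
    have h3 : (δ - ε) ^ 2 ≤ dist q.1 z ^ 2 := pow_le_pow_left₀ (by linarith) h2 2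
    have h4 : D * Real.exp (-(l * dist q.1 z ^ 2)) ≤ D * Real.exp (-(l * (δ - ε) ^ 2)) := by
      gcongr
    linarith
  · dsimp only
    refine (tugAverage_dist_sub_exp_le hp hε hδ hεδ (hΩ x hx.1) hD hl hlε _).trans ?_
    have hr : dist x z ^ 2 ≤ r ^ 2 := pow_le_pow_left₀ dist_nonneg (hΩr x hx.1) 2
    -- A round costs `ε² / (4 μ)` in time and `ε² / (2 δ)` in curvature; `hDl` says that the
    -- exponential gain, smallest at distance `r`, pays for both.
    have h1 : D * (l * Real.exp (-(l * r ^ 2))) ≤ D * (l * Real.exp (-(l * dist x z ^ 2))) := by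
      gcongr
    have h2 := mul_le_mul_of_nonneg_right (hDl.trans h1) (sq_nonneg ε)
    have h3 : (t₀ - (t - ε ^ 2 / 2)) / (2 * μ) + ε ^ 2 / (2 * δ) =
        (t₀ - t) / (2 * μ) + (1 / (4 * μ) + 1 / (2 * δ)) * ε ^ 2 := by
      field_simp
      ring
    linarith

/-- Barrier for large steps, built on the expected exit time when pulling away from `z`. -/
theorem isParabolicBarrier_paraboloid (hp : 2 ≤ p) (hε : 0 < ε) (hδ : 0 < δ)
    {z : Rn n} {t₀ r μ : ℝ} (hΩ : ∀ ξ ∈ Ω, δ ≤ dist ξ z) (hΩr : ∀ ξ ∈ Ω, dist ξ z ≤ r)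
    (hS : ∀ ξ ∈ boundaryStrip Ω ε, dist ξ z ≤ r + ε) (hμ : 0 < μ) :
    IsParabolicBarrier p Ω T ε z t₀ fun q =>
      (r + ε + μ / 2 + (t₀ - q.2) / (2 * μ) + 1 / (2 * μ * ((1 / 4) ^ n / 16)) * (r + ε) ^ 2) -
        1 / (2 * μ * ((1 / 4) ^ n / 16)) * dist q.1 z ^ 2 := by
  set m : ℝ := (1 / 4) ^ n / 16 with hm
  have hm0 : 0 < m := by positivity
  refine ⟨fun t => by fun_prop, fun q hq hqt => ?_, fun x t hx ht => ?_⟩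
  · have h1 := sqrt_le_half_add_div hμ (sub_nonneg.2 hqt)
    have h2 : dist q.1 z ≤ r + ε := (fst_mem_of_mem_region hq).elim
      (fun h => by linarith [hΩr _ h]) (hS _)
    have h3 : 1 / (2 * μ * m) * dist q.1 z ^ 2 ≤ 1 / (2 * μ * m) * (r + ε) ^ 2 := by
      gcongr
    linarith
  · have hxz : x ≠ z := dist_pos.1 (hδ.trans_le (hΩ x hx.1))
    dsimp only
    refine (tugAverage_const_sub_dist_sq_le hp hε hxz (D := 1 / (2 * μ * m)) (by positivity) _).trans ?_
    -- The paraboloid gains `ε² / (2 μ)`, twice the time cost of a round.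
    have h3 : (t₀ - (t - ε ^ 2 / 2)) / (2 * μ) - 1 / (2 * μ * m) * (m * ε ^ 2) =
        (t₀ - t) / (2 * μ) - ε ^ 2 / (4 * μ) := by
      field_simp
      ring
    have h4 : 0 ≤ ε ^ 2 / (4 * μ) := by positivity
    rw [← hm]
    linarith

theorem exp_neg_sub_exp_neg_le {a b : ℝ} (ha : 0 ≤ a) (hab : a ≤ b) :
    Real.exp (-a) - Real.exp (-b) ≤ b - a := by
  have h1 : Real.exp (-b) = Real.exp (-a) * Real.exp (a - b) := by
    rw [← Real.exp_add]; congr 1; ring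
  have h2 := Real.add_one_le_exp (a - b)
  have h3 : Real.exp (-a) ≤ 1 := Real.exp_le_one_iff.2 (by linarith)
  have h4 := Real.exp_pos (-a)
  rw [h1]
  nlinarith

/-- Barriers whose cost is controlled by the distance `d` to the boundary, uniformly in the step
size. -/
theorem exists_isParabolicBarrier_dist (n : ℕ) {p r δ : ℝ} (hp : 2 ≤ p) (hδ : 0 < δ)
    (hδr : δ ≤ r) :
    ∃ K : ℝ, 0 ≤ K ∧ ∀ (Ω : Set (Rn n)) (T ε t₀ d : ℝ) (x z : Rn n), 0 < ε → 0 ≤ d →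
      (∀ ξ ∈ Ω, δ ≤ dist ξ z) → (∀ ξ ∈ Ω, dist ξ z ≤ r) →
      (∀ ξ ∈ boundaryStrip Ω ε, δ - ε ≤ dist ξ z) →
      (∀ ξ ∈ boundaryStrip Ω ε, dist ξ z ≤ r + ε) →
      x ∈ Ω → dist x z ≤ d + ε + δ →
      ∃ W, IsParabolicBarrier p Ω T ε z t₀ W ∧
        W (x, t₀) ≤ dist x z + K * (Real.sqrt d + Real.sqrt ε + (d + ε)) := by
  set m : ℝ := (1 / 4) ^ n / 16 with hm
  have hm0 : 0 < m := by positivity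
  have hm1 : m ≤ 1 := by
    have : ((1 : ℝ) / 4) ^ n ≤ 1 := pow_le_one₀ (by norm_num) (by norm_num)
    linarith
  have hr0 : 0 < r := hδ.trans_le hδr
  set l : ℝ := 2 / (m * δ ^ 2) with hl
  have hl0 : 0 < l := by positivity
  have hlm : l * (m * δ ^ 2) = 2 := by rw [hl]; field_simp
  have hlδ : 2 ≤ l * δ ^ 2 := by
    rw [← hlm]
    gcongr
    exact mul_le_of_le_one_left (sq_nonneg δ) hm1
  set κ : ℝ := l * Real.exp (-(l * r ^ 2)) with hκ
  have hκ0 : 0 < κ := by positivity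
  set K₁ : ℝ := 4 * r * l / κ with hK₁
  have hK₁0 : 0 < K₁ := by positivity
  set K₂ : ℝ := r * Real.sqrt (2 * l) + 1 with hK₂
  have hK₂0 : 0 < K₂ := by positivity
  refine ⟨(K₁ / 4 + 1 / 2) + K₁ / (2 * δ) + (K₂ + 1 / 2 + K₂ ^ 2 / (2 * m)), by positivity, ?_⟩
  intro Ω T ε t₀ d x z hε hd hΩ hΩr hS hSr hx hxz
  have hsd := Real.sqrt_nonneg d
  have hsε := Real.sqrt_nonneg ε
  rcases le_or_gt (l * ε ^ 2) (1 / 2) with hlε | hlε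
  · have hεδ : ε ≤ δ := by
      by_contra! h
      have : δ ^ 2 ≤ ε ^ 2 := pow_le_pow_left₀ hδ.le h.le 2
      nlinarith
    -- The exponential profile costs a multiple of `D * μ²` with `D` of order `1 / μ + 1 / δ`, so
    -- this `μ` balances it against `μ / 2`.
    set μ := Real.sqrt (d + ε) with hμ
    have hμ0 : 0 < μ := Real.sqrt_pos.2 (by linarith)
    have hμ2 : μ ^ 2 = d + ε := Real.sq_sqrt (by linarith)
    have hμle : μ ≤ Real.sqrt d + Real.sqrt ε := sqrt_add_le_sqrt_add_sqrt _ _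
    set D : ℝ := (1 / (4 * μ) + 1 / (2 * δ)) / κ with hD
    have hD0 : 0 < D := by positivity
    have hDκ : D * κ = 1 / (4 * μ) + 1 / (2 * δ) := by rw [hD]; field_simp
    refine ⟨_, isParabolicBarrier_exp hp hε hδ hεδ hΩ hΩr hS hμ0 hD0.le hlm.ge hlε hDκ.ge, ?_⟩
    dsimp only
    have h1 : (δ - ε) ^ 2 ≤ dist x z ^ 2 :=
      pow_le_pow_left₀ (by linarith) (by linarith [hΩ x hx]) 2
    have h2 := exp_neg_sub_exp_neg_le (a := l * (δ - ε) ^ 2) (b := l * dist x z ^ 2)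
      (by positivity) (by gcongr)
    have h3 : dist x z ^ 2 - (δ - ε) ^ 2 ≤ 4 * r * μ ^ 2 := by
      have e1 : dist x z - (δ - ε) ≤ 2 * μ ^ 2 := by rw [hμ2]; linarith
      have e2 : dist x z + (δ - ε) ≤ 2 * r := by linarith [hΩr x hx]
      have e3 : 0 ≤ dist x z + (δ - ε) := by linarith [dist_nonneg (x := x) (y := z)]
      calc dist x z ^ 2 - (δ - ε) ^ 2 = (dist x z - (δ - ε)) * (dist x z + (δ - ε)) := by ring
        _ ≤ 2 * μ ^ 2 * (2 * r) := by gcongr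
        _ = _ := by ring
    have h4 : D * (Real.exp (-(l * (δ - ε) ^ 2)) - Real.exp (-(l * dist x z ^ 2))) ≤
        D * (l * (4 * r * μ ^ 2)) := by
      refine mul_le_mul_of_nonneg_left (h2.trans ?_) hD0.le
      rw [← mul_sub]
      gcongr
    have h5 : D * (l * (4 * r * μ ^ 2)) = K₁ / 4 * μ + K₁ / (2 * δ) * μ ^ 2 := by
      rw [hD, hK₁]
      field_simp
    have h6 : (K₁ / 4 + 1 / 2) * μ ≤ (K₁ / 4 + 1 / 2) * (Real.sqrt d + Real.sqrt ε) := by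
      gcongr
    have e1 : 0 ≤ (K₁ / 4 + 1 / 2) * (d + ε) := by positivity
    have e2 : 0 ≤ K₁ / (2 * δ) * (Real.sqrt d + Real.sqrt ε) := by positivity
    have e3 : 0 ≤ (K₂ + 1 / 2 + K₂ ^ 2 / (2 * m)) * (Real.sqrt d + Real.sqrt ε + (d + ε)) := by
      positivity
    rw [sub_self, zero_div]
    rw [hμ2] at h5
    rw [hμ2] at h4
    linarith
  -- Now `ε` is bounded below by `1 / √(2 l)`, so `r + ε ≤ K₂ ε`; with `μ = ε` the whole cost is a
  -- multiple of `ε`.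
  · refine ⟨_, isParabolicBarrier_paraboloid hp hε hδ hΩ hΩr hSr hε, ?_⟩
    dsimp only
    rw [← hm, sub_self, zero_div]
    have h1 : 1 ≤ Real.sqrt (2 * l) * ε := by
      rw [← Real.sqrt_sq hε.le, ← Real.sqrt_mul (by positivity), Real.le_sqrt (by norm_num)
        (by positivity)]
      linarith
    have h2 : r + ε ≤ K₂ * ε := by
      have := mul_le_mul_of_nonneg_left h1 hr0.le
      rw [hK₂]
      linarith
    have h3 : 1 / (2 * ε * m) * (r + ε) ^ 2 ≤ K₂ ^ 2 / (2 * m) * ε := by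
      calc _ ≤ 1 / (2 * ε * m) * (K₂ * ε) ^ 2 := by gcongr
        _ = _ := by field_simp
    have h4 : 0 ≤ 1 / (2 * ε * m) * dist x z ^ 2 := by positivity
    have e1 : 0 ≤ (K₂ + 1 / 2 + K₂ ^ 2 / (2 * m)) * (Real.sqrt d + Real.sqrt ε + d) := by
      positivity
    have e2 : 0 ≤ ((K₁ / 4 + 1 / 2) + K₁ / (2 * δ)) *
        (Real.sqrt d + Real.sqrt ε + (d + ε)) := by positivity
    have e3 := dist_nonneg (x := x) (y := z)
    linarith

theorem le_dist_of_mem_closure {z b : Rn n} (hz : ball z δ ⊆ Ωᶜ) (hb : b ∈ closure Ω) :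
    δ ≤ dist b z := by
  by_contra! h
  obtain ⟨y, hy, hyΩ⟩ := mem_closure_iff.1 hb _ isOpen_ball (mem_ball.2 h)
  exact hz hy hyΩ

theorem dist_le_of_mem_closure {z₀ a b : Rn n} {R : ℝ} (h : Ω ⊆ ball z₀ R)
    (ha : a ∈ closure Ω) (hb : b ∈ closure Ω) : dist a b ≤ 2 * R := by
  have hcl : closure Ω ⊆ closedBall z₀ R :=
    closure_minimal (h.trans ball_subset_closedBall) isClosed_closedBall
  have h1 := mem_closedBall.1 (hcl ha)
  have h2 := mem_closedBall.1 (hcl hb)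
  have := dist_triangle_right a b z₀
  linarith

/-- Nonemptiness matters: `infDist` to the empty set is `0`. -/
theorem exists_mem_frontier_dist_le {y : Rn n} (hne : (frontier Ω).Nonempty)
    (hy : y ∈ boundaryStrip Ω ε) : ∃ b ∈ frontier Ω, dist y b ≤ ε := by
  obtain ⟨b, hb, h⟩ := isClosed_frontier.exists_infDist_eq_dist hne y
  exact ⟨b, hb, h ▸ hy.2⟩

/-- The quantities `a + a'` and `b + b'` with `a' ≈ a²` and `b' ≈ b²` are comparable exactly like
`a` and `b`. -/
theorem le_mul_min_add_min {X K a a' b b' : ℝ} (hK : 0 ≤ K) (ha : 0 ≤ a) (hb : 0 ≤ b)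
    (ha₁ : a' ≤ a ^ 2) (ha₂ : a ^ 2 ≤ 2 * a') (hb₁ : b' ≤ b ^ 2) (hb₂ : b ^ 2 ≤ 2 * b')
    (hXa : X ≤ K * (a + a')) (hXb : X ≤ K * (b + b')) :
    X ≤ 2 * K * (min a b + min a' b') := by
  rcases le_total a b with h | h
  · have h2 : a ^ 2 ≤ b ^ 2 := pow_le_pow_left₀ ha h 2
    have h3 : a' / 2 ≤ min a' b' := le_min (by linarith [sq_nonneg a]) (by linarith)
    have h4 : a + a' ≤ 2 * (min a b + min a' b') := by
      rw [min_eq_left h]; linarith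
    have := mul_le_mul_of_nonneg_left h4 hK
    linarith
  · have h2 : b ^ 2 ≤ a ^ 2 := pow_le_pow_left₀ hb h 2
    have h3 : b' / 2 ≤ min a' b' := le_min (by linarith) (by linarith [sq_nonneg b])
    have h4 : b + b' ≤ 2 * (min a b + min a' b') := by
      rw [min_eq_right h]; linarith
    have := mul_le_mul_of_nonneg_left h4 hK
    linarith

end Estimates

/-! ### The boundary estimate. -/

theorem lemma4p3 (C₁ C₂ : ℝ) :
    -- `CFψ` depends only on the Lipschitz constants of `F` and `ψ`
    ∃ CFψ : ℝ, ∀ (n : ℕ) (p R δ : ℝ), 2 ≤ p → 0 < R → 0 < δ →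
      -- `C` depends only on `C₁`, `C₂`, `n`, `p`, `R` and `δ`
      ∃ C : ℝ, ∀ (Ω : Set (Rn n)) (T ε : ℝ) (F ψ u : Rn n × ℝ → ℝ),
        IsOpen Ω → IsConnected Ω → (∃ z₀ : Rn n, Ω ⊆ Metric.ball z₀ R) →
        0 < T → 0 < ε →
        ParabolicLipschitzOn C₁ F (parabolicStrip Ω T ε) →
        ParabolicLipschitzOn C₂ ψ Set.univ →
        (∀ q ∈ parabolicStrip Ω T ε, ψ q ≤ F q) →
        IsObstacleDPPSolution p Ω T ε F ψ u →
        ∀ (x : Rn n) (tx : ℝ) (y : Rn n) (ty : ℝ) (b : Rn n),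
          (x, tx) ∈ spaceTimeCylinder Ω T →
          y ∈ boundaryStrip Ω ε → ty ∈ Set.Ioc (-(ε ^ 2 / 2)) T →
          b ∈ frontier Ω → dist y b ≤ ε → HasExteriorBallAt Ω b δ →
          |u (x, tx) - u (y, ty)| ≤
            C * (min (Real.sqrt (dist x y) + Real.sqrt ε) (Real.sqrt tx + ε) +
                min (dist x y + ε) (tx + ε ^ 2)) +
              CFψ * (Real.sqrt |tx - ty| + dist x y + δ) := by
  obtain ⟨L, hL, hC₁, hC₂⟩ : ∃ L : ℝ, 0 ≤ L ∧ C₁ ≤ L ∧ C₂ ≤ L :=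
    ⟨max 0 (max C₁ C₂), le_max_left _ _, (le_max_left _ _).trans (le_max_right _ _),
      (le_max_right _ _).trans (le_max_right _ _)⟩
  -- The factor 2 covers two copies of `δ`, one from `dist x z` and one from `dist y z`.
  refine ⟨2 * L, fun n p R δ hp hR hδ => ?_⟩
  obtain ⟨K, hK0, hK⟩ := exists_isParabolicBarrier_dist n (r := 2 * R + δ) hp hδ (by linarith)
  refine ⟨2 * (L * (K + 2 / δ + 3)), ?_⟩
  rintro Ω T ε F ψ u - - ⟨z₀, hz₀⟩ - hε hF hψ hψF hu x tx y ty b hx hy hty hb hyb ⟨z, hz, hbz⟩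
  have hxΩ : x ∈ Ω := hx.1
  have htx : 0 < tx := hx.2.1
  have hbz : dist b z = δ := hbz
  have hfr : frontier Ω ⊆ closure Ω := frontier_subset_closure
  have hΩ : ∀ ξ ∈ closure Ω, δ ≤ dist ξ z := fun ξ hξ => le_dist_of_mem_closure hz hξ
  have hΩr : ∀ ξ ∈ closure Ω, dist ξ z ≤ 2 * R + δ := fun ξ hξ => by
    have := dist_triangle ξ b z
    have := dist_le_of_mem_closure hz₀ hξ (hfr hb)
    linarith
  have hS : ∀ ξ ∈ boundaryStrip Ω ε, δ - ε ≤ dist ξ z ∧ dist ξ z ≤ 2 * R + δ + ε := by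
    intro ξ hξ
    obtain ⟨c, hc, hξc⟩ := exists_mem_frontier_dist_le ⟨b, hb⟩ hξ
    have h1 := hΩ c (hfr hc)
    have h2 := hΩr c (hfr hc)
    have h3 := dist_triangle ξ c z
    have h4 := dist_triangle_left c z ξ
    constructor <;> linarith
  have hyz : dist y z ≤ ε + δ := by
    have := dist_triangle y b z
    linarith
  have hxz : dist x z ≤ dist x y + ε + δ := by
    have := dist_triangle x y z
    linarith
  have hyΓ : (y, ty) ∈ parabolicStrip Ω T ε := Or.inl ⟨hy, hty⟩
  have hd : 0 ≤ dist x y := dist_nonneg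
  obtain ⟨W, hW, hWx⟩ := hK Ω T ε tx (dist x y) x z hε hd
    (fun ξ hξ => hΩ ξ (subset_closure hξ)) (fun ξ hξ => hΩr ξ (subset_closure hξ))
    (fun ξ hξ => (hS ξ hξ).1) (fun ξ hξ => (hS ξ hξ).2) hxΩ hxz
  have hdist := hW.abs_sub_le hp hε hL hC₁ hC₂ hF hψ hψF hu hx hyΓ hyz
  have htime := (isParabolicBarrier_elapsedTime (T := T) (t₀ := tx) hp hε hδ
    fun ξ hξ => hΩ ξ (subset_closure hξ)).abs_sub_le hp hε hL hC₁ hC₂ hF hψ hψF hu hx hyΓ hyz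
  dsimp only at htime
  set τ := Real.sqrt |tx - ty|
  have hτ : 0 ≤ τ := Real.sqrt_nonneg _
  have hsd := Real.sqrt_nonneg (dist x y)
  have hsε := Real.sqrt_nonneg ε
  have hst := Real.sqrt_nonneg tx
  have hsd2 := Real.sq_sqrt hd
  have hsε2 := Real.sq_sqrt hε.le
  have hst2 := Real.sq_sqrt htx.le
  rw [← sub_le_iff_le_add]
  -- Used with `a = √|x - y| + √ε`, `a' = |x - y| + ε`, `b = √tx + ε`, `b' = tx + ε²`; the first
  -- four goals compare squares, the last two are the distance and time bounds.
  refine le_mul_min_add_min (by positivity) (by positivity) (by positivity)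
    ?_ ?_ ?_ ?_ ?_ ?_
  · nlinarith
  · nlinarith [sq_nonneg (Real.sqrt (dist x y) - Real.sqrt ε)]
  · nlinarith
  · nlinarith [sq_nonneg (Real.sqrt tx - ε)]
  · have h1 : W (x, tx) + (ε + δ) + τ ≤ 2 * (τ + dist x y + δ) +
        (K + 2 / δ + 3) * (Real.sqrt (dist x y) + Real.sqrt ε + (dist x y + ε)) := by
      have e1 : 0 ≤ 2 / δ * (Real.sqrt (dist x y) + Real.sqrt ε + (dist x y + ε)) := by
        positivity
      linarith
    have h2 := mul_le_mul_of_nonneg_left h1 hL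
    linarith
  · have h1 : dist x z + (2 / δ * (tx + ε ^ 2 / 2) + (Real.sqrt tx + ε)) + (ε + δ) + τ ≤
        2 * (τ + dist x y + δ) +
        (K + 2 / δ + 3) * (Real.sqrt tx + ε + (tx + ε ^ 2)) := by
      have e1 : 0 ≤ K * (Real.sqrt tx + ε + (tx + ε ^ 2)) := by positivity
      have e2 : 0 ≤ 2 / δ * (Real.sqrt tx + ε + ε ^ 2 / 2) := by positivity
      have e3 : 0 ≤ ε ^ 2 := sq_nonneg ε
      linarith
    have h2 := mul_le_mul_of_nonneg_left h1 hL
    linarith
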